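/- Let $d\ge 2$ and let $\Omega\subset\mathbb R^d$ be a nonempty open set whose boundary has measure zero (in particular, a Lipschitz domain). Let $\{\mathcal T_a\}_{a\in A}$ be a quasi-uniform family of triangulations of $\overline\Omega$: each $\mathcal T_a$ is a finite conforming simplicial complex with union $\overline\Omega$ all of whose maximal simplices are $d$-dimensional (these are its elements); $h_a$ is the largest diameter of an element of $\mathcal T_a$; and there are constants $\sigma$ and $\tau>0$, independent of $a$, with $h_K\le\sigma\rho_K$ and $\tau h_a\le h_K$ for every element $K$ of $\mathcal T_a$, where $h_K$ is the diameter of $K$ and $\rho_K$ is the supremum of the diameters of the balls contained in $K$. Fix finitely many linearly independent polynomial vector fields $\hat\psi_p:\mathbb R^d\to\mathbb R^d$ (local shape functions) on the reference simplex $\hat K$ with vertices $0,e_1,\dots,e_d$. For each $a$, let $V^a$ be a finite element space on $\mathcal T_a$ with global shape functions $\phi_1,\dots,\phi_N$ (with $N$ and the $\phi_i$ depending on $a$), that is: the $\phi_i$ are linearly independent vector fields on $\overline\Omega$ that lie in $H^1(\Omega)^d$, and span $V^a$; each element $K$ is the image of $\hat K$ under an affine bijection $F_K$, and on $K$ each $\phi_i$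 is either zero or equal to $\hat\psi_p\circ F_K^{-1}$ for one $p$, with different $p$ for different $i$; and each $i$ has a node $x_i$ that belongs to every element on which $\phi_i$ is not zero. (Local shape functions to which no $\phi_i$ corresponds on $K$ are allowed, as for homogeneous Dirichlet conditions.) For $\mathbf v\in\mathbb R^N$ write $v^h=\sum_i v_i\phi_i$, let $|\mathbf v|$ be the Euclidean norm and $\|\cdot\|_0$ the $L^2(\Omega)$ norm (Frobenius norm for matrix fields), and let derivatives be weak derivatives on $\Omega$. Then: (i) There is a constant $C_u>0$, independent of $a$, such that $\|v^h\|_0^2\le C_u h_a^d|\mathbf v|^2$ for all $a\in A$ and all $\mathbf v\in\mathbb R^N$. (ii) There is a constant $C^*>0$, independent of $a$, such that $\|\nabla v^h\|_0^2\le C^*h_a^{-2}\|v^h\|_0^2$ for all $a\in A$ and all $v^h\in V^a$. (iii) For any constants $C_u,C^*>0$ as in (i) and (ii), any $\lambda>0$ and any $a\in A$, the eigenvalues $\mu_i(L)$ of the symmetric divergence matrix $L\in\mathbb R^{N\times N}$, $L_{ij}=\lambda\,(\nabla\cdot\phi_j,\nabla\cdot\phi_i)_{L^2(\Omega)}$,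 satisfy $$0\le\mu_i(L)\le\lambda\,d\,C_u\,C^*\,h_a^{d-2}.$$ -/

import Mathlib

open MeasureTheory
open scoped ContDiff

noncomputable section

namespace FEM

/-- Euclidean `d`-space. -/
abbrev Space (d : ℕ) : Type := EuclideanSpace ℝ (Fin d)

/-! ### Vector fields in `H¹(Ω)`, weak gradient and weak divergence -/

/-- The field `v : Ω → ℝ^d` lies in `L²(Ω)`, and its weak gradient is the `L²(Ω)` matrix field `G`,
with `G x r s` the weak derivative `∂_s v_r` at `x`; the test functions are smooth with compact
support in `Ω`. -/
def HasWeakGrad {d : ℕ} (Ω : Set (Space d)) (v : Space d → Space d)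
    (G : Space d → Matrix (Fin d) (Fin d) ℝ) : Prop :=
  MemLp v 2 (volume.restrict Ω) ∧
  (∀ r s, MemLp (fun x => G x r s) 2 (volume.restrict Ω)) ∧
  ∀ η : Space d → ℝ, ContDiff ℝ ∞ η → HasCompactSupport η → tsupport η ⊆ Ω → ∀ r s,
    ∫ x in Ω, v x r * fderiv ℝ η x (EuclideanSpace.single s 1) = -∫ x in Ω, G x r s * η x

/-- `v ∈ H¹(Ω)^d`. -/
def MemH1 {d : ℕ} (Ω : Set (Space d)) (v : Space d → Space d) : Prop :=
  ∃ G, HasWeakGrad Ω v G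

open Classical in
/-- The weak gradient of `v` on `Ω` (unique up to null sets; zero if `v ∉ H¹(Ω)^d`). -/
def weakGrad {d : ℕ} (Ω : Set (Space d)) (v : Space d → Space d) :
    Space d → Matrix (Fin d) (Fin d) ℝ :=
  if h : MemH1 Ω v then h.choose else 0

/-- The weak divergence `∇ · v`. -/
def weakDiv {d : ℕ} (Ω : Set (Space d)) (v : Space d → Space d) (x : Space d) : ℝ :=
  (weakGrad Ω v x).trace

/-- `‖v‖₀²`, the square of the `L²(Ω)` norm of `v`. -/
def normSqL2 {d : ℕ} (Ω : Set (Space d)) (v : Space d → Space d) : ℝ :=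
  ∫ x in Ω, ‖v x‖ ^ 2

/-- `‖∇v‖₀²`, the square of the `L²(Ω)` norm of the weak gradient of `v`. -/
def gradNormSqL2 {d : ℕ} (Ω : Set (Space d)) (v : Space d → Space d) : ℝ :=
  ∫ x in Ω, ∑ r, ∑ s, weakGrad Ω v x r s ^ 2

/-! ### Triangulations -/

/-- A triangulation of `closure Ω`: a finite conforming simplicial complex, all of whose maximal
simplices are `d`-dimensional, with underlying set `closure Ω`. -/
structure Triangulation {d : ℕ} (Ω : Set (Space d)) where
  complex : Geometry.SimplicialComplex ℝ (Space d)
  finite : complex.faces.Finite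
  pure : ∀ s ∈ complex.faces, ∃ t ∈ complex.faces, s ⊆ t ∧ t.card = d + 1
  space_eq : complex.space = closure Ω

/-- The elements of the triangulation: its `d`-dimensional simplices, given by their vertices. -/
def Triangulation.elements {d : ℕ} {Ω : Set (Space d)} (T : Triangulation Ω) :
    Set (Finset (Space d)) :=
  {s | s ∈ T.complex.faces ∧ s.card = d + 1}

/-- The closed simplex with vertex set `K`. -/
def cell {d : ℕ} (K : Finset (Space d)) : Set (Space d) :=
  convexHull ℝ (K : Set (Space d))

/-- The mesh size `h`: the largest diameter of an element. -/
def Triangulation.meshSize {d : ℕ} {Ω : Set (Space d)} (T : Triangulation Ω) : ℝ :=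
  sSup ((fun K => Metric.diam (cell K)) '' T.elements)

/-- `ρ_K`: the supremum of the diameters `2 * r` of the balls contained in the set `S`. -/
def innerDiam {d : ℕ} (S : Set (Space d)) : ℝ :=
  sSup {t | ∃ (x : Space d) (r : ℝ), 0 ≤ r ∧ Metric.closedBall x r ⊆ S ∧ t = 2 * r}

/-- A family of triangulations of `closure Ω` is quasi-uniform if it is shape regular
(`h_K ≤ σ ρ_K` for all elements `K` of all its members) and, in each member, the diameters of the
elements are comparable with the mesh size (`τ h ≤ h_K`), with `σ` and `τ > 0` independent of the
member. -/
def QuasiUniform {d : ℕ} {Ω : Set (Space d)} {A : Type*} (T : A → Triangulation Ω) : Prop :=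
  (∃ σ : ℝ, ∀ a, ∀ K ∈ (T a).elements, Metric.diam (cell K) ≤ σ * innerDiam (cell K)) ∧
  (∃ τ : ℝ, 0 < τ ∧ ∀ a, ∀ K ∈ (T a).elements, τ * (T a).meshSize ≤ Metric.diam (cell K))

/-! ### Finite element spaces -/

/-- The reference simplex, with vertices `0, e_1, …, e_d`. -/
def refSimplex (d : ℕ) : Set (Space d) :=
  {x | (∀ i, 0 ≤ x i) ∧ ∑ i, x i ≤ 1}

/-- A reference finite element: linearly independent polynomial vector fields `shape p` on the
reference simplex (a basis of the local space). A scalar element used for each component of a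
vector field is the case in which the fields are `q • e_r`, with `q` a scalar shape function. -/
structure RefElement (d : ℕ) where
  m : ℕ
  shape : Fin m → Fin d → MvPolynomial (Fin d) ℝ
  indep : LinearIndependent ℝ shape

/-- An `H¹`-conforming finite element space of vector fields on a triangulation, given by its global
shape functions `φ i`. Each element `K` is the image of the reference simplex under an affine map
`F K`. The numbering `dof K` sends a local index to the global index of the shape function that it
belongs to, or to `none` if this degree of freedom has been removed (as for homogeneous Dirichlet
conditions); on `K`, the function `φ i` is the local shape function with global index `i`,
transported by `F K`, or zero if there is none. Each global degree of freedom is attached to a point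
`node i`, which lies in each element that carries it. -/
structure FESpace {d : ℕ} {Ω : Set (Space d)} (T : Triangulation Ω) (R : RefElement d) where
  /-- The number of global shape functions. -/
  N : ℕ
  φ : Fin N → Space d → Space d
  F : Finset (Space d) → (Space d ≃ᵃ[ℝ] Space d)
  dof : Finset (Space d) → Fin R.m → Option (Fin N)
  node : Fin N → Space d
  map_ref : ∀ K ∈ T.elements, F K '' refSimplex d = cell K
  dof_inj : ∀ K ∈ T.elements, ∀ p q i, dof K p = some i → dof K q = some i → p = q
  node_mem : ∀ K ∈ T.elements, ∀ p i, dof K p = some i → node i ∈ cell K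
  φ_eq : ∀ K ∈ T.elements, ∀ i, ∀ x ∈ cell K, ∀ r,
    φ i x r = ∑ p, if dof K p = some i then
      MvPolynomial.eval (fun k => (F K).symm x k) (R.shape p r) else 0
  basis : LinearIndependent ℝ fun i => (closure Ω).domRestrict (φ i)
  mem_H1 : ∀ i, MemH1 Ω (φ i)

namespace FESpace

variable {d : ℕ} {Ω : Set (Space d)} {T : Triangulation Ω} {R : RefElement d}

/-- The finite element function `v^h = ∑ i, c i • φ i` with coefficient vector `c`. -/
def toFun (V : FESpace T R) (c : EuclideanSpace ℝ (Fin V.N)) (x : Space d) : Space d :=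
  ∑ i, c i • V.φ i x

/-- The divergence matrix `L`, with `L i j = lam * (∇ · φ j, ∇ · φ i)_Ω`. -/
def divMatrix (lam : ℝ) (V : FESpace T R) : Matrix (Fin V.N) (Fin V.N) ℝ :=
  Matrix.of fun i j => lam * ∫ x in Ω, weakDiv Ω (V.φ j) x * weakDiv Ω (V.φ i) x

/-- `L` is symmetric, so that its eigenvalues (with multiplicity) can be listed. -/
theorem divMatrix_isHermitian (lam : ℝ) (V : FESpace T R) : (V.divMatrix lam).IsHermitian := by
  ext i j
  simp [divMatrix, mul_comm]

end FESpace

/-- `Cu` is an upper constant in the comparison of the `L²` norm with the norm of the coefficients: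
`‖v^h‖₀² ≤ Cu h^d |c|²` for every member of the family and each `v^h = ∑ i, c i • φ i`. -/
def IsUpperNormConst {d : ℕ} {Ω : Set (Space d)} {A : Type*} {T : A → Triangulation Ω}
    {R : RefElement d} (V : ∀ a, FESpace (T a) R) (Cu : ℝ) : Prop :=
  0 < Cu ∧ ∀ a, ∀ c : EuclideanSpace ℝ (Fin (V a).N),
    normSqL2 Ω ((V a).toFun c) ≤ Cu * (T a).meshSize ^ d * ‖c‖ ^ 2

/-- `Cstar` is a constant in the inverse inequality: `‖∇v^h‖₀² ≤ Cstar h⁻² ‖v^h‖₀²` for every member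
of the family and each `v^h` in the finite element space. -/
def IsInverseConst {d : ℕ} {Ω : Set (Space d)} {A : Type*} {T : A → Triangulation Ω}
    {R : RefElement d} (V : ∀ a, FESpace (T a) R) (Cstar : ℝ) : Prop :=
  0 < Cstar ∧ ∀ a, ∀ c : EuclideanSpace ℝ (Fin (V a).N),
    gradNormSqL2 Ω ((V a).toFun c) ≤
      Cstar * ((T a).meshSize ^ 2)⁻¹ * normSqL2 Ω ((V a).toFun c)

end FEM

end

/-! For a unit eigenvector `c` of the divergence matrix, the eigenvalue is the Rayleigh quotient,
that is, `lam` times the squared norm of the divergence of the function with coefficients `c`. The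
squared trace of a `d × d` matrix is at most `d` times its squared Frobenius norm, so (ii) followed
by (i) gives (iii), the powers of `h` combining to `h ^ (d - 2)`.

Both (i) and (ii) rest on one geometric constant: quasi-uniformity provides `κ` such that every
element contains a ball of radius `h / κ` (`QuasiUniform.exists_closedBall_subset`). A volume
comparison then bounds the number of elements through a point by `κ ^ d`
(`Triangulation.card_elements_le`). Hence each coefficient enters a bounded number of local
expansions, and (i) follows from boundedness of the local shape functions and `|K| ≤ w h ^ d`, with
`w` the volume of the unit ball.

For (ii), everything is pulled back to the reference simplex. There the `L²` norm dominates the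
coefficients, by linear independence and compactness (`RefElement.exists_lower_bound`), while the
gradient is bounded by the coefficients times the norm of the inverse linear map, which is at most
`2κ / h`. The Jacobian occurs on both sides. Summing over elements requires that the weak gradient
be the elementwise classical one (`HasWeakGrad.ae_eq_fderiv`); mesh faces and the boundary of `Ω`
are null sets. -/

noncomputable section

namespace FEM

/-! ### Weak gradients: agreement with classical derivatives, linearity, uniqueness. -/

section WeakGrad

variable {d : ℕ} {Ω : Set (Space d)}

theorem locallyIntegrableOn_of_memLp {U : Set (Space d)} (hU : IsOpen U) (hUΩ : U ⊆ Ω)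
    {g : Space d → ℝ} (hg : MemLp g 2 (volume.restrict Ω)) :
    LocallyIntegrableOn g U volume := by
  rw [locallyIntegrableOn_iff hU.isLocallyClosed]
  intro k hkU hk
  have h2 : MemLp g 2 (volume.restrict k) :=
    hg.mono_measure (Measure.restrict_mono (hkU.trans hUΩ) le_rfl)
  have : IsFiniteMeasure (volume.restrict k) := ⟨by simpa using hk.measure_lt_top⟩
  exact h2.integrable (by norm_num)

theorem setIntegral_mul_eq_integral {g η : Space d → ℝ} (hη : Function.support η ⊆ Ω) :
    ∫ x in Ω, g x * η x = ∫ x, g x * η x := by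
  apply setIntegral_eq_integral_of_forall_compl_eq_zero
  intro x hx
  have : η x = 0 := by
    by_contra h
    exact hx (hη h)
  simp [this]

theorem support_fderiv_apply_subset (η : Space d → ℝ) (e : Space d) :
    Function.support (fun x => fderiv ℝ η x e) ⊆ tsupport η := by
  intro x hx
  apply support_fderiv_subset ℝ (f := η)
  intro h
  exact hx (by simp [h])

/-- On an open set where a component of the field is `C¹`, the weak derivatives of this component
are the classical ones. -/
theorem HasWeakGrad.ae_eq_fderiv {v : Space d → Space d} {G : Space d → Matrix (Fin d) (Fin d) ℝ}
    (h : HasWeakGrad Ω v G) {U : Set (Space d)} (hU : IsOpen U) (hUΩ : U ⊆ Ω) {r : Fin d}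
    {f : Space d → ℝ} (hf : ContDiff ℝ 1 f) (hvf : ∀ x ∈ U, v x r = f x) (s : Fin d) :
    ∀ᵐ x, x ∈ U → G x r s = fderiv ℝ f x (EuclideanSpace.single s 1) := by
  set e : Space d := EuclideanSpace.single s 1
  have hf' : Continuous fun x => fderiv ℝ f x e :=
    (hf.continuous_fderiv (by norm_num)).clm_apply continuous_const
  have hGloc := locallyIntegrableOn_of_memLp hU hUΩ (h.2.1 r s)
  have key : ∀ᵐ x, x ∈ U → (fun x => G x r s - fderiv ℝ f x e) x = 0 := by
    -- Fundamental lemma of the calculus of variations: it suffices to test the difference against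
    -- smooth functions supported in `U`, where `v` may be replaced by `f` and integrated by parts.
    apply hU.ae_eq_zero_of_integral_contDiff_smul_eq_zero
    · exact hGloc.sub (hf'.locallyIntegrable.locallyIntegrableOn _)
    · intro η hη hηc hηU
      have hη' : Continuous fun x => fderiv ℝ η x e :=
        (hη.continuous_fderiv (by simp)).clm_apply continuous_const
      have hη'c : HasCompactSupport fun x => fderiv ℝ η x e :=
        hηc.fderiv_apply ℝ e
      have e1 : ∫ x in Ω, G x r s * η x = ∫ x, G x r s * η x :=
        setIntegral_mul_eq_integral ((subset_tsupport η).trans (hηU.trans hUΩ))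
      have e2 : ∫ x in Ω, v x r * fderiv ℝ η x e = ∫ x, f x * fderiv ℝ η x e := by
        rw [setIntegral_mul_eq_integral (g := fun x => v x r) (η := fun x => fderiv ℝ η x e)
          ((support_fderiv_apply_subset η e).trans (hηU.trans hUΩ))]
        congr 1 with x
        by_cases hx : x ∈ U
        · rw [hvf x hx]
        · have : fderiv ℝ η x e = 0 := by
            by_contra h0
            exact hx (hηU (support_fderiv_apply_subset η e h0))
          simp [this]
      have i1 : Integrable fun x => fderiv ℝ f x e * η x :=
        (hf'.mul hη.continuous).integrable_of_hasCompactSupport hηc.mul_left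
      have e3 : ∫ x, f x * fderiv ℝ η x e = -∫ x, fderiv ℝ f x e * η x := by
        apply integral_mul_fderiv_eq_neg_fderiv_mul_of_integrable i1
        · exact (hf.continuous.mul hη').integrable_of_hasCompactSupport hη'c.mul_left
        · exact (hf.continuous.mul hη.continuous).integrable_of_hasCompactSupport hηc.mul_left
        · exact fun x _ => (hf.differentiable (by norm_num)) x
        · exact fun x _ => (hη.differentiable (by simp)) x
      have e4 := h.2.2 η hη hηc (hηU.trans hUΩ) r s
      rw [e2, e1, e3, neg_inj] at e4
      have i2 : Integrable fun x => G x r s * η x := by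
        have hk : IntegrableOn (fun x => G x r s) (tsupport η) :=
          hGloc.integrableOn_compact_subset hηU hηc
        have : IntegrableOn (fun x => G x r s * η x) (tsupport η) :=
          hk.mul_continuousOn hη.continuous.continuousOn hηc
        rw [integrableOn_iff_integrable_of_support_subset] at this
        · exact this
        · intro x hx
          apply subset_tsupport η
          intro h0
          exact hx (by simp [h0])
      have : ∀ x, η x • (G x r s - fderiv ℝ f x e) = G x r s * η x - fderiv ℝ f x e * η x := by
        intro x; simp; ring
      simp_rw [this]
      rw [integral_sub i2 i1, e4, sub_self]
  filter_upwards [key] with x hx hxU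
  exact sub_eq_zero.1 (hx hxU)

theorem HasWeakGrad.sum {ι : Type*} (t : Finset ι) {v : ι → Space d → Space d}
    {G : ι → Space d → Matrix (Fin d) (Fin d) ℝ} (h : ∀ i ∈ t, HasWeakGrad Ω (v i) (G i))
    (c : ι → ℝ) :
    HasWeakGrad Ω (fun x => ∑ i ∈ t, c i • v i x) (fun x => ∑ i ∈ t, c i • G i x) := by
  refine ⟨memLp_finsetSum _ fun i hi => (h i hi).1.const_smul (c i), fun r s => ?_, ?_⟩
  · simp only [Matrix.sum_apply, Matrix.smul_apply]
    exact memLp_finsetSum _ fun i hi => ((h i hi).2.1 r s).const_smul (c i)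
  · intro η hη hηc hηΩ r s
    set e : Space d := EuclideanSpace.single s 1
    have hη' : Continuous fun x => fderiv ℝ η x e :=
      (hη.continuous_fderiv (by simp)).clm_apply continuous_const
    have hη'c : HasCompactSupport fun x => fderiv ℝ η x e :=
      hηc.fderiv_apply ℝ e
    have m1 : MemLp η 2 (volume.restrict Ω) :=
      (hη.continuous.memLp_of_hasCompactSupport hηc).restrict _
    have m2 : MemLp (fun x => fderiv ℝ η x e) 2 (volume.restrict Ω) :=
      (hη'.memLp_of_hasCompactSupport hη'c).restrict _
    have m3 : ∀ i ∈ t, MemLp (fun x => v i x r) 2 (volume.restrict Ω) := fun i hi =>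
      (EuclideanSpace.proj (𝕜 := ℝ) r).comp_memLp' (h i hi).1
    have l : ∀ x, (∑ i ∈ t, c i • v i x) r * fderiv ℝ η x e
        = ∑ i ∈ t, c i * (v i x r * fderiv ℝ η x e) := by
      intro x
      simp [Finset.sum_mul, mul_assoc]
    have l' : ∀ x, (∑ i ∈ t, c i • G i x) r s * η x
        = ∑ i ∈ t, c i * (G i x r s * η x) := by
      intro x
      simp [Finset.sum_mul, mul_assoc, Matrix.sum_apply]
    simp_rw [l, l']
    rw [integral_finsetSum, integral_finsetSum, ← Finset.sum_neg_distrib]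
    · refine Finset.sum_congr rfl fun i hi => ?_
      rw [integral_const_mul, integral_const_mul, (h i hi).2.2 η hη hηc hηΩ r s]
      ring
    · exact fun i hi => (((h i hi).2.1 r s).integrable_mul m1).const_mul _
    · exact fun i hi => ((m3 i hi).integrable_mul m2).const_mul _

/-- By linearity, `G - G'` is a weak gradient of `v - v = 0`; the difference is written as a sum
over `Bool` with coefficients `1` and `-1`. It therefore agrees a.e. with the classical derivative
of the zero function. -/
theorem HasWeakGrad.ae_unique (hΩ : IsOpen Ω) {v : Space d → Space d}
    {G G' : Space d → Matrix (Fin d) (Fin d) ℝ} (h : HasWeakGrad Ω v G)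
    (h' : HasWeakGrad Ω v G') : ∀ᵐ x ∂volume.restrict Ω, G x = G' x := by
  have key : ∀ r s, ∀ᵐ x, x ∈ Ω → G x r s - G' x r s = 0 := by
    have h2 := HasWeakGrad.sum (Finset.univ : Finset Bool) (v := fun _ => v)
      (G := fun b => if b then G else G') (by intro i _; cases i <;> simpa)
      (fun b => if b then 1 else -1)
    intro r s
    have h3 := h2.ae_eq_fderiv hΩ subset_rfl (r := r) (f := fun _ => 0) contDiff_const
      (by intro x _; simp) s
    filter_upwards [h3] with x hx hxΩ
    simpa [sub_eq_add_neg] using hx hxΩ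
  rw [ae_restrict_iff' hΩ.measurableSet]
  have := ae_all_iff.2 fun r => ae_all_iff.2 fun s => key r s
  filter_upwards [this] with x hx hxΩ
  ext r s
  exact sub_eq_zero.1 (hx r s hxΩ)

theorem MemH1.hasWeakGrad {v : Space d → Space d} (h : MemH1 Ω v) :
    HasWeakGrad Ω v (weakGrad Ω v) := by
  rw [weakGrad, dif_pos h]
  exact h.choose_spec

end WeakGrad

/-! ### Geometry of triangulations and of the reference simplex. -/

section Geometry

variable {d : ℕ}

theorem isCompact_cell (K : Finset (Space d)) : IsCompact (cell K) :=
  K.finite_toSet.isCompact_convexHull (𝕜 := ℝ)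

theorem measurableSet_cell (K : Finset (Space d)) : MeasurableSet (cell K) :=
  (isCompact_cell K).measurableSet

theorem innerDiam_nonneg (S : Set (Space d)) : 0 ≤ innerDiam S := by
  apply Real.sSup_nonneg
  rintro t ⟨x, r, hr, -, rfl⟩
  positivity

namespace Triangulation

variable {Ω : Set (Space d)} (T : Triangulation Ω)

theorem finite_elements : T.elements.Finite := T.finite.subset fun _ h => h.1

/-- The elements of a triangulation as a finite set. -/
def elementFinset : Finset (Finset (Space d)) := T.finite_elements.toFinset

@[simp] theorem mem_elementFinset {K : Finset (Space d)} :
    K ∈ T.elementFinset ↔ K ∈ T.elements := by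
  simp [elementFinset]

theorem iUnion_cell : ⋃ K : T.elementFinset, cell (K : Finset (Space d)) = closure Ω := by
  rw [← T.space_eq]
  apply Set.Subset.antisymm
  · apply Set.iUnion_subset
    rintro ⟨K, hK⟩
    rw [mem_elementFinset] at hK
    exact Geometry.SimplicialComplex.convexHull_subset_space hK.1
  · intro x hx
    obtain ⟨s, hs, hxs⟩ := Geometry.SimplicialComplex.mem_space_iff.1 hx
    obtain ⟨t, ht, hst, hc⟩ := T.pure s hs
    refine Set.mem_iUnion.2 ⟨⟨t, (T.mem_elementFinset).2 ⟨ht, hc⟩⟩, ?_⟩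
    exact convexHull_mono (by exact_mod_cast hst) hxs

theorem cell_subset {K : Finset (Space d)} (hK : K ∈ T.elements) : cell K ⊆ closure Ω := by
  rw [← T.iUnion_cell]
  exact Set.subset_iUnion (fun K : T.elementFinset => cell (K : Finset (Space d)))
    ⟨K, T.mem_elementFinset.2 hK⟩

theorem elements_nonempty (hne : Ω.Nonempty) : T.elements.Nonempty := by
  obtain ⟨x, hx⟩ := hne
  have := subset_closure hx
  rw [← T.iUnion_cell] at this
  obtain ⟨⟨K, hK⟩, -⟩ := Set.mem_iUnion.1 this
  exact ⟨K, T.mem_elementFinset.1 hK⟩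

theorem diam_cell_pos (hd : 0 < d) {K : Finset (Space d)} (hK : K ∈ T.elements) :
    0 < Metric.diam (cell K) := by
  have h1 : 1 < K.card := by rw [hK.2]; omega
  obtain ⟨a, ha, b, hb, hab⟩ := Finset.one_lt_card.1 h1
  refine (dist_pos.2 hab).trans_le (Metric.dist_le_diam_of_mem (isCompact_cell K).isBounded ?_ ?_)
  · exact subset_convexHull ℝ _ ha
  · exact subset_convexHull ℝ _ hb

theorem diam_cell_le {K : Finset (Space d)} (hK : K ∈ T.elements) :
    Metric.diam (cell K) ≤ T.meshSize :=
  le_csSup (T.finite_elements.image _).bddAbove ⟨K, hK, rfl⟩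

theorem meshSize_pos (hd : 0 < d) (hne : Ω.Nonempty) : 0 < T.meshSize := by
  obtain ⟨K, hK⟩ := T.elements_nonempty hne
  exact (T.diam_cell_pos hd hK).trans_le (T.diam_cell_le hK)

/-- By conformity the intersection lies in the hull of the common vertices. There are at most `d` of
these, so their affine span is a proper subspace and has measure zero. -/
theorem aedisjoint_cell {K K' : Finset (Space d)} (hK : K ∈ T.elements) (hK' : K' ∈ T.elements)
    (hne : K ≠ K') : AEDisjoint volume (cell K) (cell K') := by
  classical
  have hsub := T.complex.inter_subset_convexHull hK.1 hK'.1
  rw [← Finset.coe_inter] at hsub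
  have hlt : (K ∩ K').card < d + 1 := by
    rw [← hK.2]
    apply Finset.card_lt_card
    refine Finset.inter_subset_left.ssubset_of_ne fun h => hne ?_
    exact Finset.eq_of_subset_of_card_le (Finset.inter_eq_left.1 h) (by rw [hK.2, hK'.2])
  have hind : AffineIndependent ℝ ((↑) : ((K ∩ K' : Finset (Space d)) : Set (Space d)) → Space d) :=
    (T.complex.indep hK.1).mono (by simp)
  have hspan : affineSpan ℝ ((K ∩ K' : Finset (Space d)) : Set (Space d)) ≠ ⊤ := by
    intro h
    have := hind.affineSpan_eq_top_iff_card_eq_finrank_add_one.1 (by rw [Subtype.range_coe]; exact h)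
    simp only [Finset.coe_sort_coe, Fintype.card_coe, finrank_euclideanSpace, Fintype.card_fin]
      at this
    omega
  exact measure_mono_null (hsub.trans (convexHull_subset_affineSpan _))
    (Measure.addHaar_affineSubspace volume _ hspan)

theorem sum_setIntegral_cell (hfr : volume (frontier Ω) = 0) {f : Space d → ℝ}
    (hf : IntegrableOn f Ω) :
    ∑ K ∈ T.elementFinset, ∫ x in cell K, f x = ∫ x in Ω, f x := by
  have hcl : (closure Ω : Set (Space d)) =ᵐ[volume] Ω :=
    (closure_ae_eq_of_null_frontier hfr)
  rw [← setIntegral_congr_set hcl, ← T.iUnion_cell, integral_iUnion_ae, tsum_fintype]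
  · exact (Finset.sum_coe_sort T.elementFinset fun K => ∫ x in cell K, f x).symm
  · exact fun K => (measurableSet_cell _).nullMeasurableSet
  · rintro ⟨K, hK⟩ ⟨K', hK'⟩ hne
    rw [mem_elementFinset] at hK hK'
    exact T.aedisjoint_cell hK hK' fun h => hne (Subtype.ext h)
  · rw [T.iUnion_cell]
    exact hf.congr_set_ae hcl

theorem restrict_cell_le (hfr : volume (frontier Ω) = 0) {K : Finset (Space d)}
    (hK : K ∈ T.elements) :
    volume.restrict (cell K) ≤ (volume.restrict Ω : Measure (Space d)) := by
  rw [← Measure.restrict_congr_set (closure_ae_eq_of_null_frontier hfr)]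
  exact Measure.restrict_mono (T.cell_subset hK) le_rfl

theorem ae_mem_interior_cell (hfr : volume (frontier Ω) = 0) (hΩ : IsOpen Ω)
    {K : Finset (Space d)} (hK : K ∈ T.elements) :
    ∀ᵐ x ∂volume.restrict (cell K), x ∈ interior (cell K) ∩ Ω := by
  rw [ae_restrict_iff' (measurableSet_cell K)]
  have h1 : ∀ᵐ x : Space d, x ∉ frontier (cell K) :=
    measure_eq_zero_iff_ae_notMem.1 ((convex_convexHull ℝ _).addHaar_frontier volume)
  have h2 : ∀ᵐ x : Space d, x ∉ frontier Ω := measure_eq_zero_iff_ae_notMem.1 hfr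
  filter_upwards [h1, h2] with x hx1 hx2 hx
  constructor
  · by_contra h
    exact hx1 ⟨subset_closure hx, h⟩
  · by_contra h
    exact hx2 ⟨T.cell_subset hK hx, by rwa [hΩ.interior_eq]⟩

/-- If each element contains a ball of radius at least `h / κ`, then at most `κ ^ d` elements share
a point. -/
theorem card_elements_le (hd : 0 < d) (hne : Ω.Nonempty) {κ : ℝ} (hκ : 0 < κ)
    (hball : ∀ K ∈ T.elements, ∃ x, Metric.closedBall x (T.meshSize / κ) ⊆ cell K)
    (x : Space d) (S : Finset (Finset (Space d))) (hS : ∀ K ∈ S, K ∈ T.elements ∧ x ∈ cell K) :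
    (S.card : ℝ) ≤ κ ^ d := by
  have hh := T.meshSize_pos hd hne
  set h := T.meshSize
  -- All elements through `x` lie in the ball of radius `h` about `x`, overlap in null sets, and
  -- each has at least the volume of a ball of radius `h / κ`.
  have hsub : (⋃ K ∈ S, cell K) ⊆ Metric.closedBall x h := by
    refine Set.iUnion₂_subset fun K hK y hy => ?_
    exact (Metric.dist_le_diam_of_mem (isCompact_cell K).isBounded hy (hS K hK).2).trans
      (T.diam_cell_le (hS K hK).1)
  set w := (volume (Metric.ball (0 : Space d) 1)).toReal
  have hw : 0 < w := ENNReal.toReal_pos (Metric.measure_ball_pos _ _ one_pos).ne'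
    measure_ball_lt_top.ne
  have hvol : ∀ (y : Space d) (r : ℝ), 0 ≤ r →
      (volume (Metric.closedBall y r)).toReal = r ^ d * w := by
    intro y r hr
    rw [Measure.addHaar_closedBall _ _ hr, ENNReal.toReal_mul, finrank_euclideanSpace,
      Fintype.card_fin, ENNReal.toReal_ofReal (by positivity)]
  have h1 : ∑ K ∈ S, (volume (cell K)).toReal ≤ h ^ d * w := by
    rw [← hvol x h hh.le, ← ENNReal.toReal_sum fun K _ => (isCompact_cell K).measure_lt_top.ne,
      ← measure_biUnion_finset₀]
    · exact ENNReal.toReal_mono measure_closedBall_lt_top.ne (measure_mono hsub)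
    · exact fun K hK K' hK' hne => T.aedisjoint_cell (hS K hK).1 (hS K' hK').1 hne
    · exact fun K _ => (measurableSet_cell K).nullMeasurableSet
  have h2 : ∀ K ∈ S, (h / κ) ^ d * w ≤ (volume (cell K)).toReal := by
    intro K hK
    obtain ⟨y, hy⟩ := hball K (hS K hK).1
    rw [← hvol y (h / κ) (by positivity)]
    exact ENNReal.toReal_mono (isCompact_cell K).measure_lt_top.ne (measure_mono hy)
  have h3 := (Finset.card_nsmul_le_sum S _ _ h2).trans h1
  rw [nsmul_eq_mul, div_pow] at h3
  have h4 : (S.card : ℝ) * (h ^ d * w) ≤ κ ^ d * (h ^ d * w) := by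
    calc (S.card : ℝ) * (h ^ d * w) = κ ^ d * (S.card * (h ^ d / κ ^ d * w)) := by
          field_simp
      _ ≤ κ ^ d * (h ^ d * w) := by gcongr
  exact le_of_mul_le_mul_right h4 (by positivity)

end Triangulation

/-- Each element of a quasi-uniform family contains a ball of radius comparable to the mesh size. -/
theorem QuasiUniform.exists_closedBall_subset {Ω : Set (Space d)} (hd : 0 < d)
    {A : Type*} {T : A → Triangulation Ω} (hT : QuasiUniform T) :
    ∃ κ : ℝ, 0 < κ ∧ ∀ a, ∀ K ∈ (T a).elements, ∃ x,
      Metric.closedBall x ((T a).meshSize / κ) ⊆ cell K := by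
  obtain ⟨⟨σ, hσ⟩, τ, hτ, hτh⟩ := hT
  -- Some inscribed ball has diameter `2 * r > ρ / 2`, so `τ h ≤ σ' ρ ≤ 4 σ' r`. Replacing `σ` by
  -- `max σ 1` makes `κ` positive.
  refine ⟨4 * max σ 1 / τ, by positivity, fun a K hK => ?_⟩
  set σ' := max σ 1
  have hσ' : 0 < σ' := by positivity
  set ρ := innerDiam (cell K)
  have hK0 := (T a).diam_cell_pos hd hK
  have hle : Metric.diam (cell K) ≤ σ' * ρ :=
    (hσ a K hK).trans (mul_le_mul_of_nonneg_right (le_max_left _ _) (innerDiam_nonneg _))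
  have hρ : 0 < ρ := pos_of_mul_pos_right (hK0.trans_le hle) hσ'.le
  have hlt : ρ / 2 < ρ := by linarith
  -- The set of diameters is nonempty, since the supremum of the empty set is `0` by convention
  -- whereas `ρ > 0`.
  obtain ⟨t, ⟨x, r, hr, hxr, rfl⟩, ht⟩ := exists_lt_of_lt_csSup (by
    by_contra h
    rw [Set.not_nonempty_iff_eq_empty] at h
    apply hρ.ne'
    change sSup _ = _
    rw [h, Real.sSup_empty]) hlt
  refine ⟨x, (Metric.closedBall_subset_closedBall ?_).trans hxr⟩
  have h1 := (hτh a K hK).trans hle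
  rw [div_le_iff₀ (by positivity)]
  have h2 : τ * (T a).meshSize ≤ τ * (r * (4 * σ' / τ)) := by
    calc τ * (T a).meshSize ≤ σ' * ρ := h1
      _ ≤ σ' * (4 * r) := by gcongr; linarith
      _ = τ * (r * (4 * σ' / τ)) := by field_simp
  exact le_of_mul_le_mul_left h2 hτ

theorem refSimplex_subset_closedBall : refSimplex d ⊆ Metric.closedBall 0 1 := by
  rintro x ⟨h0, h1⟩
  rw [mem_closedBall_zero_iff, EuclideanSpace.norm_eq]
  refine Real.sqrt_le_one.2 ?_
  have hs : 0 ≤ ∑ i, x i := Finset.sum_nonneg fun i _ => h0 i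
  calc ∑ i, ‖x i‖ ^ 2 ≤ ∑ i, x i := by
        refine Finset.sum_le_sum fun i hi => ?_
        have : x i ≤ 1 := (Finset.single_le_sum (fun j _ => h0 j) hi).trans h1
        rw [Real.norm_eq_abs, sq_abs]
        nlinarith [h0 i]
    _ ≤ 1 := h1

theorem isCompact_refSimplex : IsCompact (refSimplex d) := by
  refine (isCompact_closedBall (0 : Space d) 1).of_isClosed_subset ?_ refSimplex_subset_closedBall
  have : refSimplex d = (⋂ i, {x : Space d | 0 ≤ x i}) ∩ {x | ∑ i, x i ≤ 1} := by
    ext x; simp [refSimplex]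
  rw [this]
  refine (isClosed_iInter fun i => isClosed_le continuous_const (by fun_prop)).inter
    (isClosed_le (by fun_prop) continuous_const)

/-- An open box in the reference simplex. -/
def refBox (d : ℕ) : Set (Space d) :=
  {x | ∀ i, x i ∈ Set.Ioo (0 : ℝ) (1 / (d + 1))}

theorem isOpen_refBox : IsOpen (refBox d) := by
  have : refBox d = ⋂ i, {x : Space d | x i ∈ Set.Ioo (0 : ℝ) (1 / (d + 1))} := by
    ext x; simp [refBox]
  rw [this]
  exact isOpen_iInter_of_finite fun i => isOpen_Ioo.preimage (by fun_prop)

theorem refBox_subset : refBox d ⊆ refSimplex d := by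
  intro x hx
  refine ⟨fun i => (hx i).1.le, ?_⟩
  calc ∑ i, x i ≤ ∑ _i : Fin d, (1 / (d + 1) : ℝ) := Finset.sum_le_sum fun i _ => (hx i).2.le
    _ = d / (d + 1) := by simp [div_eq_mul_inv]
    _ ≤ 1 := by rw [div_le_one (by positivity)]; linarith

end Geometry

/-! ### Estimates on the reference simplex and their affine transport. -/

section Local

variable {d : ℕ}

namespace RefElement

variable (R : RefElement d)

/-- The component `r` of the local shape function `p`. -/
def shapeFun (p : Fin R.m) (r : Fin d) (y : Space d) : ℝ :=
  MvPolynomial.eval (fun k => y k) (R.shape p r)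

/-- The component `r` of the linear combination of the local shape functions with coefficients
`b`. -/
def localFun (b : Fin R.m → ℝ) (r : Fin d) (y : Space d) : ℝ :=
  ∑ p, b p * R.shapeFun p r y

theorem contDiff_shapeFun (p : Fin R.m) (r : Fin d) : ContDiff ℝ 1 (R.shapeFun p r) := by
  have := AnalyticOnNhd.eval_continuousLinearMap' (𝕜 := ℝ)
    (fun k : Fin d => (EuclideanSpace.proj k : Space d →L[ℝ] ℝ)) (R.shape p r)
  exact this.contDiff

theorem contDiff_localFun (b : Fin R.m → ℝ) (r : Fin d) : ContDiff ℝ 1 (R.localFun b r) :=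
  ContDiff.sum fun p _ => contDiff_const.mul (R.contDiff_shapeFun p r)

theorem fderiv_localFun (b : Fin R.m → ℝ) (r : Fin d) (y w : Space d) :
    fderiv ℝ (R.localFun b r) y w = ∑ p, b p * fderiv ℝ (R.shapeFun p r) y w := by
  have h : HasFDerivAt (R.localFun b r) (∑ p, b p • fderiv ℝ (R.shapeFun p r) y) y :=
    HasFDerivAt.fun_sum fun p _ =>
      (((R.contDiff_shapeFun p r).differentiable (by norm_num)) y).hasFDerivAt.const_mul (b p)
  rw [h.fderiv]
  simp

theorem exists_bound : ∃ M : ℝ, 0 ≤ M ∧ ∀ p r, ∀ y ∈ refSimplex d,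
    |R.shapeFun p r y| ≤ M ∧ ‖fderiv ℝ (R.shapeFun p r) y‖ ≤ M := by
  have h1 : ∀ pr : Fin R.m × Fin d, ∃ C : ℝ, 0 ≤ C ∧ ∀ y ∈ refSimplex d,
      |R.shapeFun pr.1 pr.2 y| ≤ C ∧ ‖fderiv ℝ (R.shapeFun pr.1 pr.2) y‖ ≤ C := by
    rintro ⟨p, r⟩
    obtain ⟨C, hC⟩ := isCompact_refSimplex.exists_bound_of_continuousOn
      (R.contDiff_shapeFun p r).continuous.continuousOn
    obtain ⟨C', hC'⟩ := isCompact_refSimplex.exists_bound_of_continuousOn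
      ((R.contDiff_shapeFun p r).continuous_fderiv (by norm_num)).continuousOn
    refine ⟨max 0 (max C C'), le_max_left _ _, fun y hy => ⟨?_, ?_⟩⟩
    · exact (hC y hy).trans ((le_max_left _ _).trans (le_max_right _ _))
    · exact (hC' y hy).trans ((le_max_right _ _).trans (le_max_right _ _))
  choose C hC0 hC using h1
  refine ⟨∑ pr, C pr, Finset.sum_nonneg fun pr _ => hC0 pr, fun p r y hy => ?_⟩
  have h2 : C (p, r) ≤ ∑ pr, C pr :=
    Finset.single_le_sum (fun pr _ => hC0 pr) (Finset.mem_univ _)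
  exact ⟨((hC (p, r) y hy).1).trans h2, ((hC (p, r) y hy).2).trans h2⟩

theorem sq_sum_mul_le {ι : Type*} [Fintype ι] {M : ℝ} (b g : ι → ℝ) (hg : ∀ p, |g p| ≤ M) :
    (∑ p, b p * g p) ^ 2 ≤ Fintype.card ι * M ^ 2 * ∑ p, b p ^ 2 := by
  have h1 : ∑ p, g p ^ 2 ≤ Fintype.card ι * M ^ 2 := by
    refine (Finset.sum_le_sum fun p _ => (sq_le_sq' (abs_le.1 (hg p)).1 (abs_le.1 (hg p)).2)).trans
      (le_of_eq ?_)
    simp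
  refine (Finset.sum_mul_sq_le_sq_mul_sq _ _ _).trans ?_
  rw [mul_comm]
  exact mul_le_mul_of_nonneg_right h1 (Finset.sum_nonneg fun p _ => sq_nonneg _)

/-- The local shape functions are linearly independent in `L²` of the reference simplex. -/
theorem eq_zero_of_integral_eq_zero {b : Fin R.m → ℝ}
    (h : ∫ y in refSimplex d, ∑ r, R.localFun b r y ^ 2 = 0) : b = 0 := by
  have hc : Continuous fun y => ∑ r, R.localFun b r y ^ 2 :=
    continuous_finsetSum _ fun r _ => (R.contDiff_localFun b r).continuous.pow 2
  rw [setIntegral_eq_zero_iff_of_nonneg_ae (ae_of_all _ fun y =>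
    Finset.sum_nonneg fun r _ => sq_nonneg _)
    (hc.continuousOn.integrableOn_compact isCompact_refSimplex)] at h
  -- A continuous function vanishing a.e. on the open box vanishes everywhere on it.
  have h' := Measure.eqOn_open_of_ae_eq
    (ae_mono (Measure.restrict_mono refBox_subset le_rfl) h) isOpen_refBox
    hc.continuousOn continuousOn_const
  refine funext fun p => Fintype.linearIndependent_iff.1 R.indep b ?_ p
  funext r
  -- A polynomial that vanishes on a product of infinite sets is zero; this is why a box is used
  -- inside the simplex.
  apply MvPolynomial.funext_set (fun _ => Set.Ioo (0 : ℝ) (1 / (d + 1)))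
    (fun _ => Set.Ioo_infinite (by positivity))
  intro x hx
  have hy : WithLp.toLp 2 x ∈ refBox d := fun i => hx i trivial
  have h0 := (Finset.sum_eq_zero_iff_of_nonneg fun r _ => sq_nonneg _).1 (h' hy) r
    (Finset.mem_univ r)
  have h1 : R.localFun b r (WithLp.toLp 2 x) = 0 := by simpa using h0
  simpa [localFun, shapeFun, MvPolynomial.smul_eval] using h1

/-- The quadratic form `Q` is continuous and positive away from `0`, so it has a positive minimum on
the unit sphere; homogeneity extends the bound to all `b`. -/
theorem exists_lower_bound : ∃ δ : ℝ, 0 < δ ∧ ∀ b : Fin R.m → ℝ,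
    δ * ∑ p, b p ^ 2 ≤ ∫ y in refSimplex d, ∑ r, R.localFun b r y ^ 2 := by
  set Q : EuclideanSpace ℝ (Fin R.m) → ℝ := fun b =>
    ∫ y in refSimplex d, ∑ r, R.localFun b r y ^ 2
  have hQ : Continuous Q := by
    refine continuous_parametric_integral_of_continuous ?_ isCompact_refSimplex
    refine continuous_finsetSum _ fun r _ => Continuous.pow ?_ 2
    refine continuous_finsetSum _ fun p _ => Continuous.mul (by fun_prop) ?_
    exact (R.contDiff_shapeFun p r).continuous.comp continuous_snd
  have hhom : ∀ (t : ℝ) b, Q (t • b) = t ^ 2 * Q b := by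
    intro t b
    simp only [Q]
    rw [← integral_const_mul]
    congr 1 with y
    rw [Finset.mul_sum]
    refine Finset.sum_congr rfl fun r _ => ?_
    rw [← mul_pow, localFun, localFun, Finset.mul_sum]
    simp [mul_assoc]
  have hpos : ∀ b, b ≠ 0 → 0 < Q b := by
    intro b hb
    refine lt_of_le_of_ne (integral_nonneg fun y => Finset.sum_nonneg fun r _ => sq_nonneg _) ?_
    intro h
    apply hb
    have := R.eq_zero_of_integral_eq_zero h.symm
    ext p
    simpa using congrFun this p
  obtain ⟨δ, hδ, hδQ⟩ : ∃ δ : ℝ, 0 < δ ∧ ∀ b ∈ Metric.sphere (0 : EuclideanSpace ℝ (Fin R.m)) 1,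
      δ ≤ Q b := by
    -- The sphere is empty when `R.m = 0`, and any positive `δ` then serves.
    rcases (Metric.sphere (0 : EuclideanSpace ℝ (Fin R.m)) 1).eq_empty_or_nonempty with h | h
    · exact ⟨1, one_pos, by simp [h]⟩
    · obtain ⟨b, hb, hmin⟩ := (isCompact_sphere _ _).exists_isMinOn h hQ.continuousOn
      refine ⟨Q b, hpos b ?_, fun b' hb' => hmin hb'⟩
      rintro rfl
      simp at hb
  refine ⟨δ, hδ, fun b => ?_⟩
  set b' : EuclideanSpace ℝ (Fin R.m) := WithLp.toLp 2 b
  have hn : ∑ p, b p ^ 2 = ‖b'‖ ^ 2 := by rw [EuclideanSpace.real_norm_sq_eq]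
  change _ ≤ Q b'
  rw [hn]
  rcases eq_or_ne b' 0 with h | h
  · rw [h, norm_zero]
    simp only [Q]
    refine le_trans (by simp) (integral_nonneg fun y => Finset.sum_nonneg fun r _ => sq_nonneg _)
  · have hb' : 0 < ‖b'‖ := norm_pos_iff.2 h
    have h1 := hδQ (‖b'‖⁻¹ • b') (by simp [norm_smul, hb'.ne'])
    rw [hhom, inv_pow, inv_mul_eq_div, le_div_iff₀ (by positivity)] at h1
    exact h1

end RefElement

variable (F : Space d ≃ᵃ[ℝ] Space d)

theorem hasFDerivAt_affineEquiv (x : Space d) :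
    HasFDerivAt F (LinearMap.toContinuousLinearMap (F.linear : Space d →ₗ[ℝ] Space d)) x := by
  have h : (F : Space d → Space d) = fun y =>
      LinearMap.toContinuousLinearMap (F.linear : Space d →ₗ[ℝ] Space d) y + F 0 := by
    funext y
    have := F.map_vadd 0 y
    simpa using this
  rw [h]
  exact (ContinuousLinearMap.hasFDerivAt _).add_const _

theorem setIntegral_image_affineEquiv {S : Set (Space d)} (hS : MeasurableSet S)
    (g : Space d → ℝ) :
    ∫ x in F '' S, g x =
      |LinearMap.det (F.linear : Space d →ₗ[ℝ] Space d)| * ∫ y in S, g (F y) := by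
  rw [integral_image_eq_integral_abs_det_fderiv_smul volume hS
    (fun x _ => (hasFDerivAt_affineEquiv F x).hasFDerivWithinAt) F.injective.injOn g,
    ← integral_const_mul]
  rfl

/-- `F.symm` maps the ball of radius `ρ` into the unit ball, so a vector of length `ρ`, as the
difference of two points of the ball, has an image of length at most `2`. Scaling by `t = ρ / ‖u‖`
gives the general case. -/
theorem norm_symm_linear_le {x₀ : Space d} {ρ : ℝ} (hρ : 0 < ρ)
    (h : Metric.closedBall x₀ ρ ⊆ F '' refSimplex d) (u : Space d) :
    ‖F.symm.linear u‖ ≤ 2 / ρ * ‖u‖ := by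
  have hmem : ∀ z ∈ Metric.closedBall x₀ ρ, ‖F.symm z‖ ≤ 1 := by
    intro z hz
    obtain ⟨y, hy, rfl⟩ := h hz
    simpa using refSimplex_subset_closedBall hy
  rcases eq_or_ne u 0 with rfl | hu
  · simp
  have hu' : 0 < ‖u‖ := norm_pos_iff.2 hu
  set t := ρ / ‖u‖
  have ht : 0 < t := by positivity
  have h1 : t • F.symm.linear u = F.symm (t • u + x₀) - F.symm x₀ := by
    have := F.symm.map_vadd x₀ (t • u)
    simp only [vadd_eq_add, map_smul] at this
    rw [this, add_sub_cancel_right]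
  have h2 : t * ‖F.symm.linear u‖ ≤ 2 := by
    calc t * ‖F.symm.linear u‖ = ‖t • F.symm.linear u‖ := by
          rw [norm_smul, Real.norm_of_nonneg ht.le]
      _ ≤ ‖F.symm (t • u + x₀)‖ + ‖F.symm x₀‖ := by rw [h1]; exact norm_sub_le _ _
      _ ≤ 1 + 1 := by
          gcongr
          · apply hmem
            rw [mem_closedBall_iff_norm, add_sub_cancel_right, norm_smul,
              Real.norm_of_nonneg ht.le, div_mul_cancel₀ _ hu'.ne']
          · exact hmem _ (Metric.mem_closedBall_self hρ.le)
      _ = 2 := by norm_num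
  rw [mul_comm, ← le_div_iff₀ ht] at h2
  calc ‖F.symm.linear u‖ ≤ 2 / t := h2
    _ = 2 / ρ * ‖u‖ := by simp only [t]; field_simp

theorem fderiv_comp_symm {f : Space d → ℝ} (hf : ContDiff ℝ 1 f) (x w : Space d) :
    fderiv ℝ (fun x => f (F.symm x)) x w = fderiv ℝ f (F.symm x) (F.symm.linear w) := by
  have h := ((hf.differentiable (by norm_num)) (F.symm x)).hasFDerivAt.comp x
    (hasFDerivAt_affineEquiv F.symm x)
  have h' : fderiv ℝ (fun x => f (F.symm x)) x = _ := h.fderiv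
  rw [h']
  rfl

theorem contDiff_comp_symm {f : Space d → ℝ} (hf : ContDiff ℝ 1 f) :
    ContDiff ℝ 1 fun x => f (F.symm x) := by
  have h : ContDiff ℝ 1 (F.symm : Space d → Space d) :=
    (F.symm.toContinuousAffineEquiv : Space d →ᴬ[ℝ] Space d).contDiff
  exact hf.comp h

/-- The square of the Frobenius norm of the transported gradient, on the image of the reference
simplex. -/
def gradSq (R : RefElement d) (b : Fin R.m → ℝ) (x : Space d) : ℝ :=
  ∑ r, ∑ s, fderiv ℝ (fun x => R.localFun b r (F.symm x)) x (EuclideanSpace.single s 1) ^ 2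

theorem continuous_gradSq (R : RefElement d) (b : Fin R.m → ℝ) : Continuous (gradSq F R b) := by
  refine continuous_finsetSum _ fun r _ => continuous_finsetSum _ fun s _ => Continuous.pow ?_ 2
  exact ((contDiff_comp_symm F (R.contDiff_localFun b r)).continuous_fderiv
    (by norm_num)).clm_apply continuous_const

/-- The inverse inequality on one element. -/
theorem exists_local_inverse (R : RefElement d) : ∃ C : ℝ, 0 ≤ C ∧
    ∀ (F : Space d ≃ᵃ[ℝ] Space d) (x₀ : Space d) (ρ : ℝ), 0 < ρ →
      Metric.closedBall x₀ ρ ⊆ F '' refSimplex d → ∀ b : Fin R.m → ℝ,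
        ∫ x in F '' refSimplex d, gradSq F R b x ≤
          C / ρ ^ 2 * ∫ x in F '' refSimplex d, ∑ r, R.localFun b r (F.symm x) ^ 2 := by
  obtain ⟨M, hM0, hM⟩ := R.exists_bound
  obtain ⟨δ, hδ, hlow⟩ := R.exists_lower_bound
  -- There are `d * d` entries; `R.m * M ^ 2` comes from Cauchy–Schwarz over the shape functions,
  -- and the factor `2` from the bound `2 / ρ` on the inverse linear map.
  set B : ℝ := d * d * R.m * (2 * M) ^ 2
  have hB : 0 ≤ B := by positivity
  set w : ℝ := (volume (refSimplex d)).toReal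
  refine ⟨B * w / δ, by positivity, fun F x₀ ρ hρ hball b => ?_⟩
  have hmeas := (isCompact_refSimplex (d := d)).measurableSet
  set D := |LinearMap.det (F.linear : Space d →ₗ[ℝ] Space d)|
  have hD : 0 ≤ D := abs_nonneg _
  set β := ∑ p, b p ^ 2
  have hpt : ∀ y ∈ refSimplex d, gradSq F R b (F y) ≤ B / ρ ^ 2 * β := by
    intro y hy
    have h1 : ∀ r s, fderiv ℝ (fun x => R.localFun b r (F.symm x)) (F y)
        (EuclideanSpace.single s 1) ^ 2 ≤ R.m * (M * (2 / ρ)) ^ 2 * β := by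
      intro r s
      rw [fderiv_comp_symm F (R.contDiff_localFun b r), F.symm_apply_apply, R.fderiv_localFun]
      have := RefElement.sq_sum_mul_le (M := M * (2 / ρ)) b (fun p =>
        fderiv ℝ (R.shapeFun p r) y (F.symm.linear (EuclideanSpace.single s 1))) (by
          intro p
          refine ((fderiv ℝ (R.shapeFun p r) y).le_opNorm _).trans ?_
          gcongr
          · exact (hM p r y hy).2
          · simpa using norm_symm_linear_le F hρ hball (EuclideanSpace.single s 1))
      simpa using this
    calc gradSq F R b (F y) ≤ ∑ _r : Fin d, ∑ _s : Fin d, R.m * (M * (2 / ρ)) ^ 2 * β :=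
          Finset.sum_le_sum fun r _ => Finset.sum_le_sum fun s _ => h1 r s
      _ = B / ρ ^ 2 * β := by
          simp only [Finset.sum_const, Finset.card_univ, Fintype.card_fin, nsmul_eq_mul, B]
          field_simp
  -- The same Jacobian `D` multiplies both sides, so no bound on it is needed.
  rw [setIntegral_image_affineEquiv F hmeas, setIntegral_image_affineEquiv F hmeas]
  have hFc : Continuous F := F.toContinuousAffineEquiv.continuous
  have h2 : ∫ y in refSimplex d, gradSq F R b (F y) ≤ w * (B / ρ ^ 2 * β) := by
    have : ∫ _y in refSimplex d, B / ρ ^ 2 * β = w * (B / ρ ^ 2 * β) := by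
      rw [setIntegral_const]; rfl
    rw [← this]
    refine setIntegral_mono_on ?_ ?_ hmeas hpt
    · exact ((continuous_gradSq F R b).comp hFc).continuousOn.integrableOn_compact
        isCompact_refSimplex
    · exact continuousOn_const.integrableOn_compact isCompact_refSimplex
  have h3 := hlow b
  simp only [F.symm_apply_apply]
  set I := ∫ y in refSimplex d, ∑ r, R.localFun b r y ^ 2
  calc D * ∫ y in refSimplex d, gradSq F R b (F y) ≤ D * (w * (B / ρ ^ 2 * β)) := by gcongr
    _ = B * w / δ / ρ ^ 2 * (D * (δ * β)) := by field_simp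
    _ ≤ B * w / δ / ρ ^ 2 * (D * I) := by gcongr

/-- The local shape functions are bounded by the coefficients. -/
theorem exists_local_bound (R : RefElement d) : ∃ C : ℝ, 0 ≤ C ∧
    ∀ (b : Fin R.m → ℝ), ∀ y ∈ refSimplex d,
      ∑ r, R.localFun b r y ^ 2 ≤ C * ∑ p, b p ^ 2 := by
  obtain ⟨M, hM0, hM⟩ := R.exists_bound
  refine ⟨d * (R.m * M ^ 2), by positivity, fun b y hy => ?_⟩
  calc ∑ r, R.localFun b r y ^ 2 ≤ ∑ _r : Fin d, R.m * M ^ 2 * ∑ p, b p ^ 2 := by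
        refine Finset.sum_le_sum fun r _ => ?_
        simpa [RefElement.localFun] using RefElement.sq_sum_mul_le (M := M) b (fun p => R.shapeFun p r y)
          fun p => (hM p r y hy).1
    _ = d * (R.m * M ^ 2) * ∑ p, b p ^ 2 := by simp; ring

end Local

/-! ### Global estimates by summation over elements. -/

namespace FESpace

variable {d : ℕ} {Ω : Set (Space d)} {T : Triangulation Ω} {R : RefElement d} (V : FESpace T R)

/-- The coefficients on the element `K` of the function with global coefficients `c`. -/
def localCoeff (K : Finset (Space d)) (c : EuclideanSpace ℝ (Fin V.N)) (p : Fin R.m) : ℝ :=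
  (V.dof K p).elim 0 c

theorem toFun_apply {K : Finset (Space d)} (hK : K ∈ T.elements)
    (c : EuclideanSpace ℝ (Fin V.N)) {x : Space d} (hx : x ∈ cell K) (r : Fin d) :
    V.toFun c x r = R.localFun (V.localCoeff K c) r ((V.F K).symm x) := by
  have h1 : V.toFun c x r = ∑ i, c i * V.φ i x r := by simp [toFun]
  simp_rw [h1, V.φ_eq K hK _ x hx r, Finset.mul_sum]
  rw [Finset.sum_comm, RefElement.localFun]
  refine Finset.sum_congr rfl fun p _ => ?_
  rw [localCoeff, RefElement.shapeFun]
  cases hp : V.dof K p with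
  | none => simp
  | some j => simp

theorem norm_sq_toFun {K : Finset (Space d)} (hK : K ∈ T.elements)
    (c : EuclideanSpace ℝ (Fin V.N)) {x : Space d} (hx : x ∈ cell K) :
    ‖V.toFun c x‖ ^ 2 = ∑ r, R.localFun (V.localCoeff K c) r ((V.F K).symm x) ^ 2 := by
  rw [EuclideanSpace.real_norm_sq_eq]
  exact Finset.sum_congr rfl fun r _ => by rw [V.toFun_apply hK c hx]

/-- For fixed `p` and `i`, the elements with `dof K p = some i` all contain `node i`, so there are
at most `κ ^ d` of them; the sum over `p` contributes the factor `R.m`. -/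
theorem sum_localCoeff_sq_le (hd : 0 < d) (hne : Ω.Nonempty) {κ : ℝ} (hκ : 0 < κ)
    (hball : ∀ K ∈ T.elements, ∃ x, Metric.closedBall x (T.meshSize / κ) ⊆ cell K)
    (c : EuclideanSpace ℝ (Fin V.N)) :
    ∑ K ∈ T.elementFinset, ∑ p, V.localCoeff K c p ^ 2 ≤ R.m * κ ^ d * ‖c‖ ^ 2 := by
  have h1 : ∀ K p, V.localCoeff K c p ^ 2 = ∑ i, if V.dof K p = some i then c i ^ 2 else 0 := by
    intro K p
    rw [localCoeff]
    cases hp : V.dof K p with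
    | none => simp
    | some j => simp
  have h2 : ∀ p i, ∑ K ∈ T.elementFinset, (if V.dof K p = some i then c i ^ 2 else 0)
      ≤ κ ^ d * c i ^ 2 := by
    intro p i
    rw [← Finset.sum_filter, Finset.sum_const, nsmul_eq_mul]
    gcongr
    refine T.card_elements_le hd hne hκ hball (V.node i) _ fun K hK => ?_
    rw [Finset.mem_filter, Triangulation.mem_elementFinset] at hK
    exact ⟨hK.1, V.node_mem K hK.1 p i hK.2⟩
  simp_rw [h1]
  rw [Finset.sum_comm]
  calc ∑ p, ∑ K ∈ T.elementFinset, ∑ i, (if V.dof K p = some i then c i ^ 2 else 0)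
      ≤ ∑ _p : Fin R.m, κ ^ d * ‖c‖ ^ 2 := by
        refine Finset.sum_le_sum fun p _ => ?_
        rw [Finset.sum_comm, EuclideanSpace.real_norm_sq_eq, Finset.mul_sum]
        exact Finset.sum_le_sum fun i _ => h2 p i
    _ = R.m * κ ^ d * ‖c‖ ^ 2 := by simp; ring

theorem hasWeakGrad_toFun (c : EuclideanSpace ℝ (Fin V.N)) :
    HasWeakGrad Ω (V.toFun c) (fun x => ∑ i, c i • weakGrad Ω (V.φ i) x) :=
  HasWeakGrad.sum Finset.univ (fun i _ => (V.mem_H1 i).hasWeakGrad) c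

theorem memH1_toFun (c : EuclideanSpace ℝ (Fin V.N)) : MemH1 Ω (V.toFun c) :=
  ⟨_, V.hasWeakGrad_toFun c⟩

theorem integrableOn_norm_sq (c : EuclideanSpace ℝ (Fin V.N)) :
    IntegrableOn (fun x => ‖V.toFun c x‖ ^ 2) Ω :=
  (V.hasWeakGrad_toFun c).1.integrable_norm_pow (by norm_num)

theorem _root_.FEM.HasWeakGrad.integrable_sum_sq {v : Space d → Space d}
    {G : Space d → Matrix (Fin d) (Fin d) ℝ} (h : HasWeakGrad Ω v G) :
    IntegrableOn (fun x => ∑ r, ∑ s, G x r s ^ 2) Ω :=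
  integrable_finsetSum _ fun r _ => integrable_finsetSum _ fun s _ => (h.2.1 r s).integrable_sq

theorem normSqL2_le (hd : 0 < d) (hne : Ω.Nonempty) (hfr : volume (frontier Ω) = 0)
    {κ : ℝ} (hκ : 0 < κ)
    (hball : ∀ K ∈ T.elements, ∃ x, Metric.closedBall x (T.meshSize / κ) ⊆ cell K)
    {C : ℝ} (hC0 : 0 ≤ C) (hC : ∀ (b : Fin R.m → ℝ), ∀ y ∈ refSimplex d,
      ∑ r, R.localFun b r y ^ 2 ≤ C * ∑ p, b p ^ 2) (c : EuclideanSpace ℝ (Fin V.N)) :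
    normSqL2 Ω (V.toFun c) ≤ (volume (Metric.ball (0 : Space d) 1)).toReal * C * (R.m * κ ^ d) *
      T.meshSize ^ d * ‖c‖ ^ 2 := by
  set w := (volume (Metric.ball (0 : Space d) 1)).toReal
  have hh := (T.meshSize_pos hd hne).le
  rw [normSqL2, ← T.sum_setIntegral_cell hfr (V.integrableOn_norm_sq c)]
  have hK : ∀ K ∈ T.elementFinset, ∫ x in cell K, ‖V.toFun c x‖ ^ 2 ≤
      w * C * T.meshSize ^ d * ∑ p, V.localCoeff K c p ^ 2 := by
    intro K hK
    rw [Triangulation.mem_elementFinset] at hK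
    have hvol : (volume (cell K)).toReal ≤ T.meshSize ^ d * w := by
      obtain ⟨x, hx⟩ := hball K hK
      have hxK : x ∈ cell K :=
        hx (Metric.mem_closedBall_self (div_nonneg hh hκ.le))
      have hsub : cell K ⊆ Metric.closedBall x T.meshSize := fun y hy =>
        (Metric.dist_le_diam_of_mem (isCompact_cell K).isBounded hy hxK).trans
          (T.diam_cell_le hK)
      refine (ENNReal.toReal_mono measure_closedBall_lt_top.ne (measure_mono hsub)).trans
        (le_of_eq ?_)
      rw [Measure.addHaar_closedBall _ _ hh, ENNReal.toReal_mul, finrank_euclideanSpace,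
        Fintype.card_fin, ENNReal.toReal_ofReal (by positivity)]
    set β := ∑ p, V.localCoeff K c p ^ 2
    have hβ : 0 ≤ β := Finset.sum_nonneg fun p _ => sq_nonneg _
    calc ∫ x in cell K, ‖V.toFun c x‖ ^ 2 ≤ ∫ _x in cell K, C * β := by
          refine setIntegral_mono_on
            (Integrable.mono_measure (V.integrableOn_norm_sq c) (T.restrict_cell_le hfr hK))
            (continuousOn_const.integrableOn_compact (isCompact_cell K)) (measurableSet_cell K) ?_
          intro x hx
          rw [V.norm_sq_toFun hK c hx]
          apply hC
          rw [← V.map_ref K hK] at hx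
          obtain ⟨y, hy, rfl⟩ := hx
          simpa using hy
      _ = (volume (cell K)).toReal * (C * β) := by rw [setIntegral_const]; rfl
      _ ≤ T.meshSize ^ d * w * (C * β) := by gcongr
      _ = w * C * T.meshSize ^ d * β := by ring
  refine (Finset.sum_le_sum hK).trans ?_
  rw [← Finset.mul_sum]
  have hw : 0 ≤ w := ENNReal.toReal_nonneg
  calc w * C * T.meshSize ^ d * ∑ K ∈ T.elementFinset, ∑ p, V.localCoeff K c p ^ 2
      ≤ w * C * T.meshSize ^ d * (R.m * κ ^ d * ‖c‖ ^ 2) := by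
        gcongr
        exact V.sum_localCoeff_sq_le hd hne hκ hball c
    _ = w * C * (R.m * κ ^ d) * T.meshSize ^ d * ‖c‖ ^ 2 := by ring

theorem gradNormSqL2_le (hd : 0 < d) (hΩ : IsOpen Ω) (hne : Ω.Nonempty)
    (hfr : volume (frontier Ω) = 0) {κ : ℝ} (hκ : 0 < κ)
    (hball : ∀ K ∈ T.elements, ∃ x, Metric.closedBall x (T.meshSize / κ) ⊆ cell K)
    {C : ℝ} (hC : ∀ (F : Space d ≃ᵃ[ℝ] Space d) (x₀ : Space d) (ρ : ℝ), 0 < ρ →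
      Metric.closedBall x₀ ρ ⊆ F '' refSimplex d → ∀ b : Fin R.m → ℝ,
        ∫ x in F '' refSimplex d, gradSq F R b x ≤
          C / ρ ^ 2 * ∫ x in F '' refSimplex d, ∑ r, R.localFun b r (F.symm x) ^ 2)
    (c : EuclideanSpace ℝ (Fin V.N)) :
    gradNormSqL2 Ω (V.toFun c) ≤
      C * κ ^ 2 * (T.meshSize ^ 2)⁻¹ * normSqL2 Ω (V.toFun c) := by
  have hh := T.meshSize_pos hd hne
  have hG := (V.memH1_toFun c).hasWeakGrad
  rw [gradNormSqL2, normSqL2, ← T.sum_setIntegral_cell hfr hG.integrable_sum_sq,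
    ← T.sum_setIntegral_cell hfr (V.integrableOn_norm_sq c), Finset.mul_sum]
  refine Finset.sum_le_sum fun K hK => ?_
  rw [Triangulation.mem_elementFinset] at hK
  set b := V.localCoeff K c
  have e1 : ∫ x in cell K, ∑ r, ∑ s, weakGrad Ω (V.toFun c) x r s ^ 2
      = ∫ x in cell K, gradSq (V.F K) R b x := by
    -- The function is given by polynomials in the open set `interior (cell K) ∩ Ω`, which exhausts
    -- the cell up to a null set.
    apply integral_congr_ae
    have h1 : ∀ r s, ∀ᵐ x ∂volume.restrict (cell K), x ∈ interior (cell K) ∩ Ω →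
        weakGrad Ω (V.toFun c) x r s =
          fderiv ℝ (fun x => R.localFun b r ((V.F K).symm x)) x (EuclideanSpace.single s 1) :=
      fun r s => ae_restrict_of_ae <| hG.ae_eq_fderiv (isOpen_interior.inter hΩ)
        Set.inter_subset_right (contDiff_comp_symm (V.F K) (R.contDiff_localFun b r))
        (fun x hx => V.toFun_apply hK c (interior_subset hx.1) r) s
    have h2 := ae_all_iff.2 fun r => ae_all_iff.2 fun s => h1 r s
    filter_upwards [h2, T.ae_mem_interior_cell hfr hΩ hK] with x hx hxK
    exact Finset.sum_congr rfl fun r _ => Finset.sum_congr rfl fun s _ => by rw [hx r s hxK]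
  have e2 : ∫ x in cell K, ‖V.toFun c x‖ ^ 2
      = ∫ x in cell K, ∑ r, R.localFun b r ((V.F K).symm x) ^ 2 :=
    setIntegral_congr_fun (measurableSet_cell K) fun x hx => V.norm_sq_toFun hK c hx
  obtain ⟨x₀, hx₀⟩ := hball K hK
  rw [← V.map_ref K hK] at hx₀
  have h3 := hC (V.F K) x₀ (T.meshSize / κ) (by positivity) hx₀ b
  rw [V.map_ref K hK] at h3
  rw [e1, e2]
  refine h3.trans (le_of_eq ?_)
  congr 1
  field_simp

/-! ### The quadratic form and the eigenvalues of the divergence matrix. -/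

theorem dotProduct_divMatrix_mulVec (lam : ℝ) (c : EuclideanSpace ℝ (Fin V.N)) :
    (c : Fin V.N → ℝ) ⬝ᵥ (V.divMatrix lam).mulVec c =
      lam * ∫ x in Ω, (∑ i, c i * weakDiv Ω (V.φ i) x) ^ 2 := by
  have hm : ∀ i, MemLp (weakDiv Ω (V.φ i)) 2 (volume.restrict Ω) := fun i =>
    memLp_finsetSum Finset.univ fun r _ => (V.mem_H1 i).hasWeakGrad.2.1 r r
  have h1 : ∀ x, (∑ i, c i * weakDiv Ω (V.φ i) x) ^ 2 =
      ∑ i, ∑ j, c i * c j * (weakDiv Ω (V.φ j) x * weakDiv Ω (V.φ i) x) := by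
    intro x
    rw [sq, Finset.sum_mul_sum]
    exact Finset.sum_congr rfl fun i _ => Finset.sum_congr rfl fun j _ => by ring
  have hint : ∀ i j, Integrable
      (fun x => c i * c j * (weakDiv Ω (V.φ j) x * weakDiv Ω (V.φ i) x))
      (volume.restrict Ω) := fun i j => ((hm j).integrable_mul (hm i)).const_mul _
  simp_rw [h1]
  rw [integral_finsetSum _ fun i _ => integrable_finsetSum _ fun j _ => hint i j, Finset.mul_sum]
  refine Finset.sum_congr rfl fun i _ => ?_
  rw [integral_finsetSum _ fun j _ => hint i j, Matrix.mulVec, dotProduct, Finset.mul_sum,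
    Finset.mul_sum]
  refine Finset.sum_congr rfl fun j _ => ?_
  rw [integral_const_mul, divMatrix, Matrix.of_apply]
  ring

theorem integral_div_sq_le (hΩ : IsOpen Ω) (c : EuclideanSpace ℝ (Fin V.N)) :
    ∫ x in Ω, (∑ i, c i * weakDiv Ω (V.φ i) x) ^ 2 ≤ d * gradNormSqL2 Ω (V.toFun c) := by
  have hG := (V.memH1_toFun c).hasWeakGrad
  rw [gradNormSqL2, ← integral_const_mul]
  refine integral_mono_of_nonneg (ae_of_all _ fun x => sq_nonneg _)
    (hG.integrable_sum_sq.const_mul _) ?_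
  -- The weak gradients of `v^h` and of the `φ i` are separate choices, so linearity of the
  -- divergence holds only a.e., through uniqueness.
  filter_upwards [hG.ae_unique hΩ (V.hasWeakGrad_toFun c)] with x hx
  have h1 : ∑ i, c i * weakDiv Ω (V.φ i) x = ∑ r, weakGrad Ω (V.toFun c) x r r := by
    simp [hx, weakDiv, Matrix.trace, Matrix.sum_apply, Finset.mul_sum]
    rw [Finset.sum_comm]
  simp only [h1]
  -- Cauchy–Schwarz on the trace gives the factor `d`; the off-diagonal squares are then added.
  calc (∑ r, weakGrad Ω (V.toFun c) x r r) ^ 2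
      ≤ d * ∑ r, weakGrad Ω (V.toFun c) x r r ^ 2 := by
        simpa using sq_sum_le_card_mul_sum_sq (s := Finset.univ)
          (f := fun r => weakGrad Ω (V.toFun c) x r r)
    _ ≤ d * ∑ r, ∑ s, weakGrad Ω (V.toFun c) x r s ^ 2 := by
        gcongr with r
        exact Finset.single_le_sum (f := fun s => weakGrad Ω (V.toFun c) x r s ^ 2)
          (fun s _ => sq_nonneg _) (Finset.mem_univ r)

theorem eigenvalues_divMatrix (lam : ℝ) (i : Fin V.N) :
    (V.divMatrix_isHermitian lam).eigenvalues i =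
      lam * ∫ x in Ω, (∑ j, (V.divMatrix_isHermitian lam).eigenvectorBasis i j *
        weakDiv Ω (V.φ j) x) ^ 2 := by
  rw [← V.dotProduct_divMatrix_mulVec, Matrix.IsHermitian.eigenvalues_eq]
  simp

end FESpace

end FEM

end

theorem lemma5p3 {d : ℕ} (hd : 2 ≤ d) (Ω : Set (FEM.Space d)) (hΩ : IsOpen Ω)
    (hne : Ω.Nonempty) (hfr : MeasureTheory.volume (frontier Ω) = 0)
    {A : Type*} (T : A → FEM.Triangulation Ω) (hT : FEM.QuasiUniform T)
    (R : FEM.RefElement d) (V : ∀ a, FEM.FESpace (T a) R) :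
    (∃ Cu, FEM.IsUpperNormConst V Cu) ∧
    (∃ Cstar, FEM.IsInverseConst V Cstar) ∧
    ∀ Cu Cstar : ℝ, FEM.IsUpperNormConst V Cu → FEM.IsInverseConst V Cstar →
      ∀ lam : ℝ, 0 < lam → ∀ a, ∀ i : Fin (V a).N,
        0 ≤ ((V a).divMatrix_isHermitian lam).eigenvalues i ∧
        ((V a).divMatrix_isHermitian lam).eigenvalues i ≤
          lam * d * Cu * Cstar * (T a).meshSize ^ (d - 2) := by
  have hd0 : 0 < d := by omega
  have hpos : ∀ a, 0 < (T a).meshSize := fun a => (T a).meshSize_pos hd0 hne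
  obtain ⟨κ, hκ, hball⟩ := hT.exists_closedBall_subset hd0
  refine ⟨?_, ?_, ?_⟩
  · obtain ⟨C, hC0, hC⟩ := FEM.exists_local_bound R
    -- The summand `1` ensures strict positivity, as `C` is only known to be nonnegative; likewise
    -- for the inverse constant.
    refine ⟨(MeasureTheory.volume (Metric.ball (0 : FEM.Space d) 1)).toReal * C *
      (R.m * κ ^ d) + 1, by positivity, fun a c => ?_⟩
    refine ((V a).normSqL2_le hd0 hne hfr hκ (hball a) hC0 hC c).trans ?_
    have := (hpos a).le
    gcongr
    linarith
  · obtain ⟨C, hC0, hC⟩ := FEM.exists_local_inverse R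
    refine ⟨C * κ ^ 2 + 1, by positivity, fun a c => ?_⟩
    refine ((V a).gradNormSqL2_le hd0 hΩ hne hfr hκ (hball a) hC c).trans ?_
    have : 0 ≤ FEM.normSqL2 Ω ((V a).toFun c) :=
      MeasureTheory.integral_nonneg fun x => sq_nonneg _
    gcongr
    linarith
  · intro Cu Cstar hCu hCs lam hlam a i
    rw [(V a).eigenvalues_divMatrix]
    set c := ((V a).divMatrix_isHermitian lam).eigenvectorBasis i with hc
    have hnorm : ‖c‖ = 1 := OrthonormalBasis.norm_eq_one _ i
    refine ⟨mul_nonneg hlam.le (MeasureTheory.integral_nonneg fun x => sq_nonneg _), ?_⟩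
    have h1 := (V a).integral_div_sq_le hΩ c
    have h2 := hCs.2 a c
    have h3 := hCu.2 a c
    rw [hnorm, one_pow, mul_one] at h3
    have h := hpos a
    have hCs0 := hCs.1
    -- The exponent `d - 2` is a truncated subtraction, so `2 ≤ d` is needed to split the power.
    have hpow : (T a).meshSize ^ d = (T a).meshSize ^ 2 * (T a).meshSize ^ (d - 2) := by
      rw [← pow_add]
      congr 1
      omega
    calc lam * ∫ x in Ω, (∑ j, c j * FEM.weakDiv Ω ((V a).φ j) x) ^ 2
        ≤ lam * (d * (Cstar * ((T a).meshSize ^ 2)⁻¹ * (Cu * (T a).meshSize ^ d))) := by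
          gcongr
          refine h1.trans ?_
          gcongr
          refine h2.trans ?_
          gcongr
      _ = lam * d * Cu * Cstar * (T a).meshSize ^ (d - 2) := by
          rw [hpow]
          field_simp
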